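/- A tournament is a finite digraph without loops that has exactly one arc between every two distinct vertices; we write $X\Rightarrow Y$ if every arc between the disjoint vertex sets $X$ and $Y$ goes from $X$ to $Y$. For a tournament $T$ and a total ordering $<$ of $V(T)$, the backedge graph $B(T,<)$ is the graph on $V(T)$ with edge set $\{uv : u<v,\ vu\in A(T)\}$, and the clique number of $T$ is $\overrightarrow{\omega}(T)=\min_{<}\omega(B(T,<))$, where the minimum ranges over all total orderings $<$ of $V(T)$ and $\omega$ is the usual clique number of a graph. A tournament $T$ contains a tournament $S$ if some subtournament of $T$ is isomorphic to $S$. Let $A_1$ and $D_1$ be the one-vertex tournament. For $n\ge 2$, let $D_n$ be the disjoint union of two copies $X,Y$ of $D_{n-1}$ and a vertex $z$ with $X\Rightarrow Y\Rightarrow z\Rightarrow X$, and let $A_n$ be the disjoint union of $n-1$ copies $T_1,\dots,T_{n-1}$ of $A_{n-1}$ and vertices $v_1,\dots,v_n$ such that $v_j\Rightarrow v_i$ and $T_i\Rightarrow T_j$ whenever $i<j$, $v_i\Rightarrow T_j$ whenever $i\le j$, and $T_j\Rightarrow v_i$ whenever $i>j$. Let $\omega_A(T)$ and $\omega_D(T)$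 be the largest $n\ge 1$ such that $T$ contains $A_n$, respectively $D_n$ (both are $0$ if $T$ has no vertices). Theorem. (1) For every integer $n\ge 1$ there is a constant $c_n$ such that every tournament $T$ that contains neither $A_n$ nor $D_n$ satisfies $\overrightarrow{\omega}(T)\le c_n$. (2) There is a function $f:\mathbb{N}\to\mathbb{N}$ such that every tournament $T$ satisfies $\overrightarrow{\omega}(T)<f(\omega_A(T)+\omega_D(T))$. -/

import Mathlib

/-- A tournament on the vertex set `V`: a loopless digraph with exactly one arc between any two
distinct vertices. `T.Adj u v` means that there is an arc from `u` to `v`. -/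
structure Tournament (V : Type*) extends Digraph V where
  loopless : ∀ v, ¬ Adj v v
  adj_iff_not_adj : ∀ u v, u ≠ v → (Adj u v ↔ ¬ Adj v u)

namespace Tournament

/-- The backedge graph of `T` with respect to the total ordering `o` of the vertices: `u` and `v`,
where `u` precedes `v`, are adjacent iff the arc between them goes from `v` to `u`. -/
def backedgeGraph {V : Type*} (T : Tournament V) (o : LinearOrder V) : SimpleGraph V where
  Adj u v := (o.lt u v ∧ T.Adj v u) ∨ (o.lt v u ∧ T.Adj u v)
  symm := ⟨fun _ _ h => h.symm⟩
  loopless := ⟨fun v h => T.loopless v (h.elim And.right And.right)⟩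

/-- The clique number of a tournament: the minimum of the clique numbers of its backedge graphs,
over all total orderings of the vertices. -/
noncomputable def cliqueNum {V : Type*} (T : Tournament V) : ℕ :=
  sInf {k : ℕ | ∃ o : LinearOrder V, (T.backedgeGraph o).cliqueNum = k}

/-- `T` contains `S`: some subtournament of `T` is isomorphic to `S`. -/
def Contains {V W : Type*} (T : Tournament V) (S : Tournament W) : Prop :=
  Nonempty (S.Adj ↪r T.Adj)

/-- The tournament with no vertices. -/
def empty : Tournament Empty where
  Adj := fun _ _ => False
  loopless := fun v => v.elim
  adj_iff_not_adj := fun v => v.elim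

/-- The tournament with a single vertex. -/
def single : Tournament Unit where
  Adj := fun _ _ => False
  loopless := fun _ h => h
  adj_iff_not_adj := fun _ _ h => (h rfl).elim

/-- The arcs of `Δ(T₁, T₂, T₃)`. -/
def deltaAdj {V₁ V₂ V₃ : Type*} (T₁ : Tournament V₁) (T₂ : Tournament V₂) (T₃ : Tournament V₃) :
    V₁ ⊕ V₂ ⊕ V₃ → V₁ ⊕ V₂ ⊕ V₃ → Prop
  | .inl x, .inl y => T₁.Adj x y
  | .inl _, .inr (.inl _) => True
  | .inl _, .inr (.inr _) => False
  | .inr (.inl _), .inl _ => False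
  | .inr (.inl x), .inr (.inl y) => T₂.Adj x y
  | .inr (.inl _), .inr (.inr _) => True
  | .inr (.inr _), .inl _ => True
  | .inr (.inr _), .inr (.inl _) => False
  | .inr (.inr x), .inr (.inr y) => T₃.Adj x y

/-- `Δ(T₁, T₂, T₃)`: the disjoint union of `T₁`, `T₂`, `T₃` with all arcs from `T₁` to `T₂`, from
`T₂` to `T₃` and from `T₃` to `T₁`. -/
def delta {V₁ V₂ V₃ : Type*} (T₁ : Tournament V₁) (T₂ : Tournament V₂) (T₃ : Tournament V₃) :
    Tournament (V₁ ⊕ V₂ ⊕ V₃) where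
  Adj := deltaAdj T₁ T₂ T₃
  loopless := by
    rintro (x | x | x)
    · exact T₁.loopless x
    · exact T₂.loopless x
    · exact T₃.loopless x
  adj_iff_not_adj := by
    rintro (x | x | x) (y | y | y) h
    · exact T₁.adj_iff_not_adj x y (fun e => h (by rw [e]))
    · simp [deltaAdj]
    · simp [deltaAdj]
    · simp [deltaAdj]
    · exact T₂.adj_iff_not_adj x y (fun e => h (by rw [e]))
    · simp [deltaAdj]
    · simp [deltaAdj]
    · simp [deltaAdj]
    · exact T₃.adj_iff_not_adj x y (fun e => h (by rw [e]))

/-- The vertex set of `D n`. -/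
def DVert : ℕ → Type
  | 0 => Empty
  | n + 1 => DVert n ⊕ DVert n ⊕ Unit

/-- `D 1` is a single vertex, and `D (n + 1) = Δ(D n, D n, D 1)`. The recursion starts from the
empty tournament at `0`, so that `D 1` is the one-vertex tournament. -/
def D : (n : ℕ) → Tournament (DVert n)
  | 0 => empty
  | n + 1 => delta (D n) (D n) single

/-- The arcs of `aStep S n`. The vertex `.inl (i, x)` is the vertex `x` of the `i`-th copy of `S`;
the vertex `.inr i` is the `i`-th extra vertex. -/
def aStepAdj {W : Type*} (S : Tournament W) (n : ℕ) :
    (Fin n × W) ⊕ Fin (n + 1) → (Fin n × W) ⊕ Fin (n + 1) → Prop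
  | .inl (i, x), .inl (j, y) => i < j ∨ (i = j ∧ S.Adj x y)
  | .inl (j, _), .inr i => j.castSucc < i
  | .inr i, .inl (j, _) => i ≤ j.castSucc
  | .inr i, .inr j => j < i

/-- The tournament consisting of `n` copies `T₁, …, Tₙ` of `S` and `n + 1` extra vertices
`v₁, …, vₙ₊₁`, with all arcs from `Tᵢ` to `Tⱼ` and from `vⱼ` to `vᵢ` for `i < j`, from `vᵢ` to `Tⱼ`
for `i ≤ j`, and from `Tⱼ` to `vᵢ` for `i > j`. -/
def aStep {W : Type*} (S : Tournament W) (n : ℕ) : Tournament ((Fin n × W) ⊕ Fin (n + 1)) where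
  Adj := aStepAdj S n
  loopless := by
    rintro (⟨i, x⟩ | i)
    · simp [aStepAdj, S.loopless x]
    · simp [aStepAdj]
  adj_iff_not_adj := by
    rintro (⟨i, x⟩ | i) (⟨j, y⟩ | j) h
    · rcases lt_trichotomy i j with hij | hij | hij
      · simp [aStepAdj, hij, hij.not_gt, hij.ne']
      · subst hij
        have hxy : x ≠ y := fun e => h (by rw [e])
        simpa [aStepAdj] using S.adj_iff_not_adj x y hxy
      · simp [aStepAdj, hij, hij.not_gt, hij.ne']
    · simp [aStepAdj]
    · simp [aStepAdj]
    · have hij : i ≠ j := fun e => h (by rw [e])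
      simp only [aStepAdj, not_lt]
      exact ⟨le_of_lt, fun hle => lt_of_le_of_ne hle hij.symm⟩

/-- The vertex set of `A n`. -/
def AVert : ℕ → Type
  | 0 => Empty
  | n + 1 => (Fin n × AVert n) ⊕ Fin (n + 1)

/-- `A 1` is a single vertex, and `A (n + 1)` is built from `n` copies of `A n` and `n + 1` extra
vertices. The recursion starts from the empty tournament at `0`, so that `A 1`, which consists of
no copies and one extra vertex, is the one-vertex tournament. -/
def A : (n : ℕ) → Tournament (AVert n)
  | 0 => empty
  | n + 1 => aStep (A n) n

/-- The largest `n ≥ 1` such that `T` contains `A n` (and `0` if `T` has no vertices). -/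
noncomputable def omegaA {V : Type*} (T : Tournament V) : ℕ :=
  sSup {n : ℕ | 1 ≤ n ∧ T.Contains (A n)}

/-- The largest `n ≥ 1` such that `T` contains `D n` (and `0` if `T` has no vertices). -/
noncomputable def omegaD {V : Type*} (T : Tournament V) : ℕ :=
  sSup {n : ℕ | 1 ≤ n ∧ T.Contains (D n)}

end Tournament

/-!
The clique number of a set `X` of vertices, `cn X`, is monotone and subadditive, and `X` is absorbed
by at most `cn X` of its own vertices. The bound for tournaments without `A (a + 2)` and `D (d + 1)`
is proved by induction: by the induction hypothesis, every set of large clique number contains both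
`A (a + 1)` and `D d`. Below, a set is *heavy* or *light* if its clique number is large or small.

The argument studies the asymmetric distance `gap u v`, the clique number of the set of middle
vertices of the directed paths of length two from `u` to `v`. It satisfies the triangle inequality
up to an error of one, and it has three properties.

* It is never large in both directions (`exists_no_crossing`). If it were, the two sets of middle
  vertices would be *mixing*: no copy of `D d` in one of them is complete to a copy in the other, as
  this would give `D (d + 1)`. Then most vertices of one set split the other one into two heavy
  parts, so mixing pairs reproduce themselves into a long family of pairwise mixing heavy sets, and
  in such a family any given tournament, in particular `D (d + 1)`, can be found greedily.
* Balls, that is, sets of vertices at small distance from and to a given vertex, have bounded clique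
  number (`exists_bound_ball`). This reduces to sets in which all in-neighbourhoods have small
  clique number (`exists_bound_of_inN_light`). There copies of `A (a + 1)` can be chosen one after
  the other, each dominated by everything chosen before, including absorbing sets that provide the
  extra vertices of `A (a + 2)`.
* There is no long sequence along which all arcs go backwards and all distances forwards are large
  (`contains_A_succ_of_far_reversed`): the vertices of even index are the extra vertices of a copy
  of `A (a + 2)`, whose copies of `A (a + 1)` lie on paths between consecutive vertices.

Finally, take a longest chain in which every vertex has large distance to the next one. By
maximality, every vertex is near the chain at a well-defined position, the fibres of the position
are covered by two balls, and the distance from `u` to `v` is large if the position of `v` exceeds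
that of `u` by at least three. Within a residue class modulo three of the position, ordering by
position therefore leaves no long reversed sequences, and the orderings of the fibres are glued
together (`cn_univ_le`).
-/

namespace Tournament

universe u

variable {V W : Type*} (T : Tournament V)

/-! ### Arcs, neighbourhoods and copies -/

theorem adj_of_not_adj {u v : V} (huv : u ≠ v) (h : ¬ T.Adj u v) : T.Adj v u := by
  by_contra h'
  exact h ((T.adj_iff_not_adj u v huv).2 h')

theorem ne_of_adj {u v : V} (h : T.Adj u v) : u ≠ v := by
  rintro rfl
  exact T.loopless _ h

theorem not_adj_of_adj {u v : V} (h : T.Adj u v) : ¬ T.Adj v u :=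
  (T.adj_iff_not_adj u v (T.ne_of_adj h)).1 h

/-- The out-neighbourhood of a vertex. -/
def outN (v : V) : Set V := {x | T.Adj v x}

/-- The in-neighbourhood of a vertex. -/
def inN (v : V) : Set V := {x | T.Adj x v}

/-- `φ` preserves arcs. Between tournaments this makes `φ` an embedding. -/
def IsHom (S : Tournament W) (T : Tournament V) (φ : W → V) : Prop :=
  ∀ x y, S.Adj x y → T.Adj (φ x) (φ y)

theorem contains_iff {S : Tournament W} : T.Contains S ↔ ∃ φ : W → V, IsHom S T φ := by
  constructor
  · rintro ⟨f⟩
    exact ⟨f, fun x y h => f.map_rel_iff.2 h⟩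
  · rintro ⟨φ, hφ⟩
    have hinj : Function.Injective φ := by
      intro x y hxy
      by_contra hne
      by_cases h : S.Adj x y
      · exact T.ne_of_adj (hφ _ _ h) hxy
      · exact T.ne_of_adj (hφ _ _ (S.adj_of_not_adj hne h)) hxy.symm
    refine ⟨⟨⟨φ, hinj⟩, ?_⟩⟩
    intro x y
    refine ⟨fun h => ?_, hφ x y⟩
    by_contra hn
    have hne : x ≠ y := fun e => T.ne_of_adj h (congrArg φ e)
    exact T.not_adj_of_adj h (hφ _ _ (S.adj_of_not_adj hne hn))

/-- The vertex set `X` contains a copy of `S`. Copies are given by arc-preserving maps, which are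
automatically embeddings. -/
def ContainsIn (S : Tournament W) (X : Set V) : Prop :=
  ∃ φ : W → V, IsHom S T φ ∧ ∀ x, φ x ∈ X

/-! ### The clique number of a vertex set -/

/-- `K` is a clique of the backedge graph of the ranking `r`: all arcs inside `K` point from the
vertex of larger rank to the vertex of smaller rank. -/
def IsReversed (r : V → ℕ) (K : Finset V) : Prop :=
  ∀ u ∈ K, ∀ v ∈ K, r u < r v → T.Adj v u

/-- Some ordering of `X`, given by a ranking, has no reversed set with more than `k` vertices. -/
def OrderBound (X : Set V) (k : ℕ) : Prop :=
  ∃ r : V → ℕ, Set.InjOn r X ∧ ∀ K : Finset V, ↑K ⊆ X → T.IsReversed r K → K.card ≤ k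

/-- The clique number of the subtournament induced by `X`, defined with injective rankings `V → ℕ`
in place of total orderings. -/
noncomputable def cn (X : Set V) : ℕ := sInf {k | T.OrderBound X k}

variable {T}

theorem cn_le {X : Set V} {k : ℕ} (h : T.OrderBound X k) : T.cn X ≤ k := Nat.sInf_le h

variable (T)

theorem orderBound_cn [Finite V] (X : Set V) : T.OrderBound X (T.cn X) := by
  have : Set.Nonempty {k | T.OrderBound X k} := by
    obtain ⟨r, hr⟩ := (inferInstance : Countable V).exists_injective_nat
    refine ⟨Nat.card V, r, hr.injOn, fun K _ _ => ?_⟩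
    have := Fintype.ofFinite V
    rw [Nat.card_eq_fintype_card]
    exact Finset.card_le_univ K
  exact Nat.sInf_mem this

@[simp] theorem cn_empty : T.cn ∅ = 0 := by
  refine Nat.le_zero.1 (cn_le ⟨fun _ => 0, by simp, fun K hK _ => ?_⟩)
  simp [Finset.coe_eq_empty.1 (Set.subset_empty_iff.1 hK)]

theorem cn_singleton_le (v : V) : T.cn {v} ≤ 1 := by
  refine cn_le ⟨fun _ => 0, by simp, fun K hK _ => ?_⟩
  exact Finset.card_le_one.2 fun a ha b hb => (hK ha).trans (hK hb).symm

section Finite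

variable [Finite V]

theorem cn_mono {X Y : Set V} (h : X ⊆ Y) : T.cn X ≤ T.cn Y := by
  obtain ⟨r, hr, hK⟩ := T.orderBound_cn Y
  exact cn_le ⟨r, hr.mono h, fun K hKX => hK K (hKX.trans h)⟩

theorem cn_union_le (X Y : Set V) : T.cn (X ∪ Y) ≤ T.cn X + T.cn Y := by
  classical
  have := Fintype.ofFinite V
  obtain ⟨r, hr, hrK⟩ := T.orderBound_cn X
  obtain ⟨q, hq, hqK⟩ := T.orderBound_cn Y
  -- list `X` first, ordered by `r`, and then the rest of `Y`, ordered by `q`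
  set N := Finset.univ.sup r + 1
  have hN : ∀ x, r x < N := fun x => Nat.lt_succ_of_le (Finset.le_sup (Finset.mem_univ x))
  refine cn_le ⟨fun x => if x ∈ X then r x else N + q x, ?_, ?_⟩
  · intro x hx y hy hxy
    have h1 := hN x
    have h2 := hN y
    by_cases hxX : x ∈ X <;> by_cases hyX : y ∈ X <;> simp only [hxX, hyX, if_true, if_false] at hxy
    · exact hr hxX hyX hxy
    · omega
    · omega
    · exact hq (hx.resolve_left hxX) (hy.resolve_left hyX) (by omega)
  · intro K hK hrev
    rw [← Finset.card_filter_add_card_filter_not (s := K) (fun x => x ∈ X)]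
    refine Nat.add_le_add (hrK _ (fun x hx => (Finset.mem_filter.1 hx).2) ?_)
      (hqK _ (fun x hx => ?_) ?_)
    · intro u hu v hv huv
      rw [Finset.mem_filter] at hu hv
      exact hrev u hu.1 v hv.1 (by simpa [hu.2, hv.2] using huv)
    · have hx' := Finset.mem_filter.1 hx
      exact (hK hx'.1).resolve_left hx'.2
    · intro u hu v hv huv
      rw [Finset.mem_filter] at hu hv
      exact hrev u hu.1 v hv.1 (by simpa [hu.2, hv.2] using huv)

theorem cn_biUnion_le {ι : Type*} (s : Finset ι) (B : ι → Set V) :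
    T.cn (⋃ i ∈ s, B i) ≤ ∑ i ∈ s, T.cn (B i) := by
  classical
  induction s using Finset.induction_on with
  | empty => simp
  | insert i s hi ih =>
    rw [Finset.set_biUnion_insert, Finset.sum_insert hi]
    exact (T.cn_union_le _ _).trans (Nat.add_le_add_left ih _)

/-- Removing from `X` sets `B i` with clique number at most `m` costs at most `m` for each. -/
theorem cn_le_add_card_mul {ι : Type*} {X Y : Set V} {s : Finset ι} {B : ι → Set V} {m : ℕ}
    (h : ∀ x ∈ X, x ∈ Y ∨ ∃ i ∈ s, x ∈ B i) (hB : ∀ i ∈ s, T.cn (B i) ≤ m) :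
    T.cn X ≤ T.cn Y + s.card * m := by
  have h1 : X ⊆ Y ∪ ⋃ i ∈ s, B i := fun x hx => by
    rcases h x hx with h | ⟨i, hi, hx⟩
    · exact Or.inl h
    · exact Or.inr (Set.mem_biUnion hi hx)
  refine (T.cn_mono h1).trans ((T.cn_union_le _ _).trans (Nat.add_le_add_left ?_ _))
  refine (T.cn_biUnion_le s B).trans ?_
  simpa using Finset.sum_le_card_nsmul s _ m hB

theorem cn_insert_le (v : V) (X : Set V) : T.cn (insert v X) ≤ T.cn X + 1 := by
  rw [Set.insert_eq, Set.union_comm]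
  exact (T.cn_union_le _ _).trans (Nat.add_le_add_left (T.cn_singleton_le v) _)

/-- Adding one vertex raises the clique number by at most one, so all intermediate values occur. -/
theorem exists_subset_cn_eq (X : Set V) : ∀ k ≤ T.cn X, ∃ U ⊆ X, T.cn U = k := by
  induction X, X.toFinite using Set.Finite.induction_on with
  | empty =>
    intro k hk
    exact ⟨∅, subset_rfl, by simpa using hk.antisymm' (by simp)⟩
  | insert _ _ ih =>
    rename_i v X _ _
    intro k hk
    rcases Nat.lt_or_ge (T.cn X) k with h | h
    · exact ⟨_, subset_rfl, le_antisymm ((T.cn_insert_le v X).trans h) hk⟩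
    · obtain ⟨U, hU, hUk⟩ := ih k h
      exact ⟨U, hU.trans (Set.subset_insert v X), hUk⟩

/-- A vertex set is absorbed by a few of its own vertices: the last vertex in an optimal ordering
receives arcs from all vertices except those of a set with smaller clique number. -/
theorem exists_absorbing (X : Set V) :
    ∃ E : Finset V, ↑E ⊆ X ∧ E.card ≤ T.cn X ∧ ∀ u ∈ X, u ∈ E ∨ ∃ e ∈ E, T.Adj u e := by
  classical
  obtain ⟨r, hr, hK⟩ := T.orderBound_cn X
  generalize T.cn X = k at hK
  induction k generalizing X with
  | zero =>
    refine ⟨∅, by simp, by simp, fun u hu => ?_⟩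
    have := hK {u} (by simpa using hu) (by intro a ha b hb hab; simp_all)
    simp at this
  | succ k ih =>
    rcases X.eq_empty_or_nonempty with rfl | hne
    · exact ⟨∅, by simp, by simp, by simp⟩
    -- a reversed set of out-neighbours of the last vertex `m` stays reversed when `m` is added
    obtain ⟨m, hm, hmax⟩ := Set.exists_max_image X r X.toFinite hne
    obtain ⟨E, hE, hcard, habs⟩ := ih (X ∩ T.outN m) (hr.mono Set.inter_subset_left) (by
      intro K hKX hrev
      have hmK : m ∉ K := fun h => T.loopless m (hKX h).2
      have := hK (insert m K) (by
        intro x hx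
        rcases Finset.mem_insert.1 hx with rfl | hx
        · exact hm
        · exact (hKX hx).1) (by
        intro u hu v hv huv
        rcases Finset.mem_insert.1 hu with rfl | huK <;>
          rcases Finset.mem_insert.1 hv with rfl | hvK
        · exact absurd huv (lt_irrefl _)
        · exact absurd huv (not_lt.2 (hmax v (hKX hvK).1))
        · exact (hKX huK).2
        · exact hrev u huK v hvK huv)
      rw [Finset.card_insert_of_notMem hmK] at this
      omega)
    refine ⟨insert m E, ?_, (Finset.card_insert_le _ _).trans (by omega), fun u hu => ?_⟩
    · intro x hx
      rcases Finset.mem_insert.1 hx with rfl | hx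
      · exact hm
      · exact (hE hx).1
    · by_cases hum : u = m
      · exact Or.inl (by simp [hum])
      by_cases hadj : T.Adj u m
      · exact Or.inr ⟨m, by simp, hadj⟩
      rcases habs u ⟨hu, T.adj_of_not_adj hum hadj⟩ with h | ⟨e, he, h⟩
      · exact Or.inl (Finset.mem_insert_of_mem h)
      · exact Or.inr ⟨e, Finset.mem_insert_of_mem he, h⟩

theorem cliqueNum_le_cn_univ : T.cliqueNum ≤ T.cn Set.univ := by
  classical
  have := Fintype.ofFinite V
  obtain ⟨r, hr, hK⟩ := T.orderBound_cn Set.univ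
  have hinj : Function.Injective r := Set.injOn_univ.1 hr
  let o : LinearOrder V := LinearOrder.lift' r hinj
  have hlt : ∀ u v, o.lt u v ↔ r u < r v := fun u v => Iff.rfl
  refine (Nat.sInf_le ⟨o, rfl⟩ : T.cliqueNum ≤ (T.backedgeGraph o).cliqueNum).trans ?_
  obtain ⟨K, hKc⟩ := (T.backedgeGraph o).exists_isNClique_cliqueNum
  rw [← hKc.card_eq]
  refine hK K (Set.subset_univ _) fun u hu v hv huv => ?_
  have hne : u ≠ v := fun e => by simp [e] at huv
  rcases hKc.isClique hu hv hne with h | h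
  · exact h.2
  · exact absurd ((hlt v u).1 h.1) (not_lt.2 huv.le)

end Finite

/-! ### Building copies of `A (n + 1)` and `D (n + 1)` -/

/-- The copies `f i`, for `i < n`, and the extra vertices `v i`, for `i ≤ n`, are indexed by natural
numbers; their values at larger indices are irrelevant. -/
theorem contains_aStep {S : Tournament W} {n : ℕ} {f : ℕ → W → V} {v : ℕ → V}
    (hf : ∀ i < n, IsHom S T (f i))
    (hff : ∀ i j, i < j → j < n → ∀ x y, T.Adj (f i x) (f j y))
    (hvv : ∀ i j, i < j → j ≤ n → T.Adj (v j) (v i))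
    (hvf : ∀ i j, i ≤ j → j < n → ∀ x, T.Adj (v i) (f j x))
    (hfv : ∀ i j, j < i → i ≤ n → ∀ x, T.Adj (f j x) (v i)) :
    T.Contains (aStep S n) := by
  refine T.contains_iff.2 ⟨Sum.elim (fun p => f p.1 p.2) (fun i => v i), ?_⟩
  rintro (⟨i, x⟩ | i) (⟨j, y⟩ | j) h
  · rcases h with h | ⟨rfl, h⟩
    · exact hff i j h j.2 x y
    · exact hf i i.2 x y h
  · exact hfv j i h (Nat.lt_succ_iff.1 j.2) x
  · exact hvf i j h j.2 y
  · exact hvv j i h (Nat.lt_succ_iff.1 i.2)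

theorem contains_D_succ {n : ℕ} {f g : DVert n → V} {z : V} (hf : IsHom (D n) T f)
    (hg : IsHom (D n) T g) (hfg : ∀ x y, T.Adj (f x) (g y)) (hgz : ∀ y, T.Adj (g y) z)
    (hzf : ∀ x, T.Adj z (f x)) : T.Contains (D (n + 1)) := by
  refine T.contains_iff.2 ⟨Sum.elim f (Sum.elim g fun _ => z), ?_⟩
  rintro (x | x | x) (y | y | y) h
  · exact hf x y h
  · exact hfg x y
  · exact h.elim
  · exact h.elim
  · exact hg x y h
  · exact hgz x
  · exact hzf y
  · exact h.elim
  · exact h.elim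

instance finite_AVert : ∀ n, Finite (AVert n)
  | 0 => inferInstanceAs (Finite Empty)
  | n + 1 =>
    have := finite_AVert n
    inferInstanceAs (Finite ((Fin n × AVert n) ⊕ Fin (n + 1)))

instance finite_DVert : ∀ n, Finite (DVert n)
  | 0 => inferInstanceAs (Finite Empty)
  | n + 1 =>
    have := finite_DVert n
    inferInstanceAs (Finite (DVert n ⊕ DVert n ⊕ Unit))

instance nonempty_AVert (n : ℕ) : Nonempty (AVert (n + 1)) := ⟨Sum.inr 0⟩

/-! ### Reversing all arcs -/

/-- The tournament obtained by reversing all arcs. -/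
def op : Tournament V where
  Adj u v := T.Adj v u
  loopless := T.loopless
  adj_iff_not_adj u v h := T.adj_iff_not_adj v u h.symm

variable {T} in
theorem OrderBound.op [Finite V] {X : Set V} {k : ℕ} (h : T.OrderBound X k) :
    T.op.OrderBound X k := by
  have := Fintype.ofFinite V
  obtain ⟨r, hr, hK⟩ := h
  have hM : ∀ x, r x ≤ Finset.univ.sup r := fun x => Finset.le_sup (Finset.mem_univ x)
  refine ⟨fun x => Finset.univ.sup r - r x, fun x hx y hy hxy => hr hx hy ?_, fun K hKX hrev =>
    hK K hKX fun u hu v hv huv => hrev v hv u hu ?_⟩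
  · have := hM x
    have := hM y
    dsimp only at hxy
    omega
  · have := hM u
    have := hM v
    dsimp only
    omega

theorem cn_op [Finite V] (X : Set V) : T.op.cn X = T.cn X :=
  le_antisymm (cn_le (T.orderBound_cn X).op) (cn_le (T := T) (T.op.orderBound_cn X).op)

/-- `A n` is isomorphic to its reverse: reverse the order of the copies and of the extra
vertices. -/
theorem exists_isHom_A_op : ∀ n, ∃ φ : AVert n → AVert n, IsHom (A n) (A n).op φ
  | 0 => ⟨id, fun x => x.elim⟩
  | n + 1 => by
    obtain ⟨φ, hφ⟩ := exists_isHom_A_op n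
    refine ⟨Sum.elim (fun p => Sum.inl (p.1.rev, φ p.2)) (fun i => Sum.inr i.rev), ?_⟩
    rintro (⟨i, x⟩ | i) (⟨j, y⟩ | j) h
    · rcases h with h | ⟨rfl, h⟩
      · exact Or.inl (Fin.rev_lt_rev.2 h)
      · exact Or.inr ⟨rfl, hφ x y h⟩
    · change j.rev ≤ i.rev.castSucc
      change i.castSucc < j at h
      simp only [Fin.lt_def, Fin.le_def, Fin.val_castSucc, Fin.val_rev] at h ⊢
      omega
    · change j.rev.castSucc < i.rev
      change i ≤ j.castSucc at h
      simp only [Fin.lt_def, Fin.le_def, Fin.val_castSucc, Fin.val_rev] at h ⊢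
      omega
    · exact Fin.rev_lt_rev.2 h

theorem containsIn_op_A {n : ℕ} {X : Set V} (h : T.ContainsIn (A n) X) :
    T.op.ContainsIn (A n) X := by
  obtain ⟨f, hf, hX⟩ := h
  obtain ⟨φ, hφ⟩ := exists_isHom_A_op n
  exact ⟨f ∘ φ, fun x y hxy => hf _ _ (hφ x y hxy), fun x => hX _⟩

theorem contains_iff_containsIn_univ {S : Tournament W} :
    T.Contains S ↔ T.ContainsIn S Set.univ := by
  simp [contains_iff, ContainsIn]

/-! ### Sets in which all in-neighbourhoods have small clique number -/

/-- The cost of removing, from a set in which in-neighbourhoods have clique number at most `H`, all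
vertices that do not receive an arc from each vertex of `P`. -/
theorem cn_le_cn_dominated_add [Finite V] {Z : Set V} {H : ℕ}
    (hZ : ∀ v ∈ Z, T.cn (T.inN v ∩ Z) ≤ H) {P : Finset V} (hP : ↑P ⊆ Z) :
    T.cn Z ≤ T.cn {x ∈ Z | ∀ y ∈ P, T.Adj y x} + P.card * (H + 1) := by
  classical
  refine T.cn_le_add_card_mul (B := fun y => insert y (T.inN y ∩ Z)) (fun x hx => ?_)
    fun y hy => (T.cn_insert_le _ _).trans (Nat.add_le_add_right (hZ y (hP hy)) 1)
  by_cases h : ∀ y ∈ P, T.Adj y x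
  · exact Or.inl ⟨hx, h⟩
  · push Not at h
    obtain ⟨y, hy, hyx⟩ := h
    refine Or.inr ⟨y, hy, ?_⟩
    by_cases hxy : x = y
    · exact Or.inl hxy
    · exact Or.inr ⟨T.adj_of_not_adj (Ne.symm hxy) hyx, hx⟩

/-- In a heavy set `Z` with light in-neighbourhoods, `n` copies `f i` of `S` can be chosen, each
dominated by all earlier ones and by the given vertices `P` and `Y`, so that every `u ∈ U` dominated
by all of them comes with vertices `e i` that complete the `f i` and `u` to a copy of `aStep S n`.
The sets `P` and `Y` carry the induction: they collect the earlier absorbing sets, and the earlier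
copies. The `e i` also dominate a given set `C ⊆ P`, which stands for the extra vertices found
earlier, and are dominated by `Y`. Since `C` is known only once `u` is, absorbing sets are prepared
for every `C ⊆ P`. -/
theorem exists_copies_and_absorbers [Finite W] [Nonempty W] (S : Tournament W) (c H G n : ℕ) :
    ∀ p : ℕ, ∃ t : ℕ, ∀ {V : Type u} [Finite V] (T : Tournament V),
      (∀ X, c < T.cn X → T.ContainsIn S X) → ∀ Z U : Set V,
      (∀ v ∈ Z, T.cn (T.inN v ∩ Z) ≤ H) → T.cn U ≤ G → U ⊆ Z →
      ∀ P Y : Finset V, ↑P ⊆ Z → ↑Y ⊆ Z → P.card ≤ p → Y.card ≤ p → t < T.cn Z →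
      ∃ f : ℕ → W → V, (∀ i < n, IsHom S T (f i)) ∧ (∀ i < n, ∀ x, f i x ∈ Z) ∧
        (∀ i < n, ∀ x, ∀ y ∈ P, T.Adj y (f i x)) ∧
        (∀ i < n, ∀ x, ∀ y ∈ Y, T.Adj y (f i x)) ∧
        (∀ i j, i < j → j < n → ∀ x y, T.Adj (f i x) (f j y)) ∧
        ∀ u ∈ U, ∀ C ⊆ P, (∀ z ∈ C, T.Adj u z) → (∀ y ∈ Y, T.Adj y u) →
          (∀ i < n, ∀ x, T.Adj (f i x) u) →
          ∃ e : ℕ → V, ∀ i < n, (∀ z ∈ C, T.Adj (e i) z) ∧ (∀ y ∈ Y, T.Adj y (e i)) ∧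
            T.Adj u (e i) ∧ (∀ j < i, T.Adj (e i) (e j)) ∧ (∀ j < i, ∀ x, T.Adj (f j x) (e i)) ∧
            ∀ j, i ≤ j → j < n → ∀ x, T.Adj (e i) (f j x) := by
  classical
  have := Fintype.ofFinite W
  induction n with
  | zero =>
    intro p
    refine ⟨0, fun {V} _ T _ Z U _ _ _ P Y _ _ _ _ ht => ?_⟩
    have hne : Z.Nonempty := by
      by_contra h
      rw [Set.not_nonempty_iff_eq_empty] at h
      simp [h] at ht
    exact ⟨fun _ _ => hne.some, by simp, by simp, by simp, by simp, by simp,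
      fun u _ C _ _ _ _ => ⟨fun _ => u, by simp⟩⟩
  | succ n ih =>
    intro p
    set q := 2 * p + 2 ^ p * G with hq
    obtain ⟨t, ht⟩ := ih (q + Fintype.card W)
    refine ⟨max t (c + q * (H + 1)), fun {V} _ T hS Z U hZ hU hUZ P Y hP hY hPp hYp hw => ?_⟩
    have hw1 := (le_max_left _ _).trans_lt hw
    have hw2 := (le_max_right _ _).trans_lt hw
    -- for each `C ⊆ P`, absorb the vertices of `U` that dominate `C` and are dominated by `Y`
    choose E hEX hEcard hEabs using fun C : Finset V =>
      T.exists_absorbing {u ∈ U | (∀ z ∈ C, T.Adj u z) ∧ ∀ y ∈ Y, T.Adj y u}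
    set E' := P.powerset.biUnion E with hE'
    have hE'U : ∀ e ∈ E', e ∈ U := by
      intro e he
      obtain ⟨C, -, he⟩ := Finset.mem_biUnion.1 he
      exact (hEX C he).1
    have hE'card : E'.card ≤ 2 ^ p * G := by
      refine Finset.card_biUnion_le_card_mul _ _ G (fun C _ => (hEcard C).trans
        ((T.cn_mono fun x hx => hx.1).trans hU)) |>.trans ?_
      rw [Finset.card_powerset]
      exact Nat.mul_le_mul_right _ (Nat.pow_le_pow_right (by norm_num) hPp)
    have hPE : (P ∪ E').card ≤ p + 2 ^ p * G :=
      (Finset.card_union_le _ _).trans (Nat.add_le_add hPp hE'card)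
    have hPEZ : ((P ∪ E' : Finset V) : Set V) ⊆ Z := by
      intro x hx
      rcases Finset.mem_union.1 hx with h | h
      · exact hP h
      · exact hUZ (hE'U x h)
    have hQZ : ((P ∪ E' ∪ Y : Finset V) : Set V) ⊆ Z := by
      intro x hx
      rcases Finset.mem_union.1 hx with h | h
      · exact hPEZ h
      · exact hY h
    have hQ : (P ∪ E' ∪ Y).card ≤ q :=
      (Finset.card_union_le _ _).trans ((Nat.add_le_add hPE hYp).trans (by omega))
    obtain ⟨f₀, hf₀, hf₀Z⟩ := hS {x ∈ Z | ∀ y ∈ P ∪ E' ∪ Y, T.Adj y x} (by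
      have := T.cn_le_cn_dominated_add hZ hQZ
      have := Nat.mul_le_mul_right (H + 1) hQ
      omega)
    set Y' := Y ∪ Finset.univ.image f₀ with hY'
    obtain ⟨f, hf, hfZ, hfP, hfY, hff, hfe⟩ := ht T hS Z U hZ hU hUZ (P ∪ E') Y' hPEZ (by
        intro x hx
        rcases Finset.mem_union.1 hx with h | h
        · exact hY h
        · obtain ⟨w, -, rfl⟩ := Finset.mem_image.1 h
          exact (hf₀Z w).1) (by omega) (by
        refine (Finset.card_union_le _ _).trans (Nat.add_le_add (by omega) ?_)
        exact Finset.card_image_le) hw1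
    have hf₀Y' : ∀ x, f₀ x ∈ Y' := fun x => by simp [hY']
    refine ⟨fun i => Nat.casesOn i f₀ f, ?_, ?_, ?_, ?_, ?_, ?_⟩
    · rintro (_ | i) hi
      · exact hf₀
      · exact hf i (by omega)
    · rintro (_ | i) hi x
      · exact (hf₀Z x).1
      · exact hfZ i (by omega) x
    · rintro (_ | i) hi x y hy
      · exact (hf₀Z x).2 y (by simp [hy])
      · exact hfP i (by omega) x y (by simp [hy])
    · rintro (_ | i) hi x y hy
      · exact (hf₀Z x).2 y (by simp [hy])
      · exact hfY i (by omega) x y (by simp [hY', hy])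
    · rintro (_ | i) (_ | j) hij hj x y
      · omega
      · exact hfY j (by omega) y _ (hf₀Y' x)
      · omega
      · exact hff i j (by omega) (by omega) x y
    · intro u hu C hC huC hYu hfu
      have hEE' : E C ⊆ E' := Finset.subset_biUnion_of_mem E (Finset.mem_powerset.2 hC)
      have hf₀u : ∀ x, T.Adj (f₀ x) u := hfu 0 (by omega)
      -- the vertices of `E C` dominate the copy `f₀`, whereas `f₀` dominates `u`
      have huE : u ∉ E C := by
        intro h
        obtain ⟨x⟩ := ‹Nonempty W›
        exact T.not_adj_of_adj (hf₀u x) ((hf₀Z x).2 u (by simp [hEE' h]))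
      obtain ⟨e₀, he₀, hue₀⟩ := (hEabs C u ⟨hu, huC, hYu⟩).resolve_left huE
      have he₀U := hEX C he₀
      obtain ⟨e, he⟩ := hfe u hu (insert e₀ C) (by
          intro z hz
          rcases Finset.mem_insert.1 hz with rfl | hz
          · simp [hEE' he₀]
          · simp [hC hz]) (by
          intro z hz
          rcases Finset.mem_insert.1 hz with rfl | hz
          · exact hue₀
          · exact huC z hz) (by
          intro y hy
          rcases Finset.mem_union.1 hy with h | h
          · exact hYu y h
          · obtain ⟨w, -, rfl⟩ := Finset.mem_image.1 h
            exact hf₀u w) (fun i hi => hfu (i + 1) (by omega))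
      refine ⟨fun i => Nat.casesOn i e₀ e, ?_⟩
      rintro (_ | i) hi
      · refine ⟨he₀U.2.1, he₀U.2.2, hue₀, by simp, by simp, ?_⟩
        rintro (_ | j) - hj x
        · exact (hf₀Z x).2 e₀ (by simp [hEE' he₀])
        · exact hfP j (by omega) x e₀ (by simp [hEE' he₀])
      · obtain ⟨h1, h2, h3, h4, h5, h6⟩ := he i (by omega)
        refine ⟨fun z hz => h1 z (by simp [hz]), fun y hy => h2 y (by simp [hY', hy]), h3, ?_, ?_,
          ?_⟩
        · rintro (_ | j) hj
          · exact h1 e₀ (by simp)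
          · exact h4 j (by omega)
        · rintro (_ | j) hj x
          · exact h2 _ (hf₀Y' x)
          · exact h5 j (by omega) x
        · rintro (_ | j) hj hjn x
          · omega
          · exact h6 j (by omega) (by omega) x

/-- Choose `a + 1` copies of `A (a + 1)` in `Z` whose absorbing vertices serve a subset `U` of `Z`.
The clique number `G` of `U` is just too large for `U` to be covered by the closed in-neighbourhoods
of the vertices of the copies, so some `u ∈ U` is dominated by all copies and `A (a + 2)`
appears. -/
theorem exists_bound_of_inN_light (a c H : ℕ) :
    ∃ g : ℕ, ∀ {V : Type u} [Finite V] (T : Tournament V),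
      ¬ T.Contains (A (a + 2)) → (∀ X, c < T.cn X → T.ContainsIn (A (a + 1)) X) → ∀ Z : Set V,
      (∀ v ∈ Z, T.cn (T.inN v ∩ Z) ≤ H) → T.cn Z ≤ g := by
  classical
  set s := Nat.card (AVert (a + 1))
  set G := (a + 1) * s * (H + 1) + 1 with hG
  obtain ⟨t, ht⟩ := exists_copies_and_absorbers.{u} (A (a + 1)) c H G (a + 1) 0
  refine ⟨max G t, fun {V} _ T hT hA Z hZ => ?_⟩
  by_contra! hw
  obtain ⟨U, hUZ, hU⟩ := T.exists_subset_cn_eq Z G (by omega)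
  obtain ⟨f, hf, hfZ, -, -, hff, hfe⟩ := ht T hA Z U hZ hU.le hUZ ∅ ∅ (by simp) (by simp) (by simp)
    (by simp) (by omega)
  by_cases hu : ∃ u ∈ U, ∀ i < a + 1, ∀ x, T.Adj (f i x) u
  · obtain ⟨u, hu, hfu⟩ := hu
    obtain ⟨e, he⟩ := hfe u hu ∅ (by simp) (by simp) (by simp) hfu
    refine hT (T.contains_aStep (v := fun i => if i < a + 1 then e i else u) hf hff ?_ ?_ ?_)
    · intro i j hij hj
      rcases Nat.lt_or_ge j (a + 1) with h | h
      · simpa [h, hij.trans h] using (he j h).2.2.2.1 i hij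
      · simpa [h.not_gt, hij.trans_le hj] using (he i (by omega)).2.2.1
    · intro i j hij hj x
      simpa [hij.trans_lt hj] using (he i (by omega)).2.2.2.2.2 j hij hj x
    · intro i j hij hi x
      rcases Nat.lt_or_ge i (a + 1) with h | h
      · simpa [h] using (he i h).2.2.2.2.1 j hij x
      · simpa [h.not_gt] using hfu j (by omega) x
  · -- otherwise `U` is covered by the closed in-neighbourhoods of the vertices of the copies
    push Not at hu
    have := Fintype.ofFinite (AVert (a + 1))
    have h := T.cn_le_add_card_mul (X := U) (Y := ∅) (m := H + 1)
      (s := (Finset.univ : Finset (Fin (a + 1) × AVert (a + 1))))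
      (B := fun p => insert (f p.1 p.2) (T.inN (f p.1 p.2) ∩ Z)) (fun v hv => by
        obtain ⟨i, hi, x, hx⟩ := hu v hv
        refine Or.inr ⟨(⟨i, hi⟩, x), Finset.mem_univ _, ?_⟩
        by_cases hvx : v = f i x
        · exact Or.inl hvx
        · exact Or.inr ⟨T.adj_of_not_adj (Ne.symm hvx) hx, hUZ hv⟩)
      fun p _ => (T.cn_insert_le _ _).trans
        (Nat.add_le_add_right (hZ _ (hfZ _ p.1.2 _)) 1)
    rw [hU, cn_empty, Finset.card_univ, Fintype.card_prod, Fintype.card_fin,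
      ← Nat.card_eq_fintype_card, zero_add] at h
    exact Nat.not_succ_le_self _ h

/-- The statement for out-neighbourhoods follows by reversing all arcs. -/
theorem exists_bound_of_outN_light (a c H : ℕ) :
    ∃ g : ℕ, ∀ {V : Type u} [Finite V] (T : Tournament V),
      ¬ T.Contains (A (a + 2)) → (∀ X, c < T.cn X → T.ContainsIn (A (a + 1)) X) → ∀ Z : Set V,
      (∀ v ∈ Z, T.cn (T.outN v ∩ Z) ≤ H) → T.cn Z ≤ g := by
  obtain ⟨g, hg⟩ := exists_bound_of_inN_light.{u} a c H
  refine ⟨g, fun {V} _ T hT hA Z hZ => ?_⟩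
  rw [← T.cn_op]
  refine hg T.op (fun h => hT ?_) (fun X hX => T.containsIn_op_A (hA X (by rwa [← T.cn_op])))
    Z (fun v hv => by rw [T.cn_op]; exact hZ v hv)
  rw [contains_iff_containsIn_univ] at h ⊢
  exact T.op.containsIn_op_A h

/-! ### Mixing pairs of sets -/

/-- The sets `P` and `Q` are mixing for `S`: no copy of `S` in one of them is complete to a copy
of `S` in the other one. -/
def Mixing (S : Tournament W) (P Q : Set V) : Prop :=
  ∀ f g : W → V, IsHom S T f → IsHom S T g → (∀ x, f x ∈ P) → (∀ x, g x ∈ Q) →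
    ¬ (∀ x y, T.Adj (f x) (g y)) ∧ ¬ (∀ x y, T.Adj (g y) (f x))

variable {T} in
theorem Mixing.symm {S : Tournament W} {P Q : Set V} (h : T.Mixing S P Q) : T.Mixing S Q P :=
  fun f g hf hg hfQ hgP => ⟨fun h' => (h g f hg hf hgP hfQ).2 fun x y => h' y x,
    fun h' => (h g f hg hf hgP hfQ).1 fun x y => h' y x⟩

variable {T} in
theorem Mixing.mono {S : Tournament W} {P Q P' Q' : Set V} (h : T.Mixing S P Q) (hP : P' ⊆ P)
    (hQ : Q' ⊆ Q) : T.Mixing S P' Q' :=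
  fun f g hf hg hfP hgQ => h f g hf hg (fun x => hP (hfP x)) fun x => hQ (hgQ x)

variable {T} in
theorem Mixing.op {S : Tournament W} {P Q : Set V} (h : T.Mixing S P Q) :
    T.op.Mixing S.op P Q :=
  fun f g hf hg hfP hgQ =>
    (h f g (fun x y => hf y x) (fun x y => hg y x) hfP hgQ).symm

/-- A copy of `D d` in `P` complete to one in `Q` forms a copy of `D (d + 1)` with `u`, and one in
`Q` complete to one in `P` forms a copy of `D (d + 1)` with `v`. -/
theorem mixing_of_crossing {d : ℕ} (hT : ¬ T.Contains (D (d + 1))) {u v : V} {P Q : Set V}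
    (hP : P ⊆ T.outN u ∩ T.inN v) (hQ : Q ⊆ T.outN v ∩ T.inN u) : T.Mixing (D d) P Q :=
  fun _ _ hf hg hfP hgQ =>
    ⟨fun h => hT (T.contains_D_succ (z := u) hf hg h (fun y => (hQ (hgQ y)).2)
      fun x => (hP (hfP x)).1),
    fun h => hT (T.contains_D_succ (z := v) hg hf (fun x y => h y x) (fun y => (hP (hfP y)).2)
      fun x => (hQ (hgQ x)).1)⟩

theorem cn_le_of_containsIn {S : Tournament W} {c : ℕ} (hS : ∀ X, c < T.cn X → T.ContainsIn S X)
    {X : Set V} (hX : ∀ f : W → V, IsHom S T f → (∀ x, f x ∈ X) → False) : T.cn X ≤ c := by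
  by_contra! h
  obtain ⟨f, hf, hfX⟩ := hS X h
  exact hX f hf hfX

section Finite

variable [Finite V]

theorem exists_dominated_copy [Finite W] {S : Tournament W} {c θ : ℕ}
    (hS : ∀ X, c < T.cn X → T.ContainsIn S X) {Q : Set V} (hQ : c + Nat.card W * (θ + 1) < T.cn Q)
    {f : W → V} (hf : ∀ x, T.cn (T.inN (f x) ∩ Q) ≤ θ) :
    ∃ g : W → V, IsHom S T g ∧ (∀ y, g y ∈ Q) ∧ ∀ x y, T.Adj (f x) (g y) := by
  have := Fintype.ofFinite W
  obtain ⟨g, hg, hgQ⟩ := hS {y ∈ Q | ∀ x, T.Adj (f x) y} (by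
    have h := T.cn_le_add_card_mul (X := Q) (Y := {y ∈ Q | ∀ x, T.Adj (f x) y}) (m := θ + 1)
      (s := (Finset.univ : Finset W)) (B := fun x => insert (f x) (T.inN (f x) ∩ Q))
      (fun y hy => by
        by_cases h : ∀ x, T.Adj (f x) y
        · exact Or.inl ⟨hy, h⟩
        · push Not at h
          obtain ⟨x, hx⟩ := h
          refine Or.inr ⟨x, Finset.mem_univ _, ?_⟩
          by_cases hyx : y = f x
          · exact Or.inl hyx
          · exact Or.inr ⟨T.adj_of_not_adj (Ne.symm hyx) hx, hy⟩)
      fun x _ => (T.cn_insert_le _ _).trans (Nat.add_le_add_right (hf x) 1)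
    rw [Finset.card_univ, ← Nat.card_eq_fintype_card] at h
    omega)
  exact ⟨g, hg, fun y => (hgQ y).1, fun x y => (hgQ y).2 x⟩

variable {T} in
theorem Mixing.cn_light_inN_le [Finite W] {S : Tournament W} {c θ : ℕ} {P Q : Set V}
    (hS : ∀ X, c < T.cn X → T.ContainsIn S X) (h : T.Mixing S P Q)
    (hQ : c + Nat.card W * (θ + 1) < T.cn Q) :
    T.cn {x ∈ P | T.cn (T.inN x ∩ Q) ≤ θ} ≤ c := by
  refine T.cn_le_of_containsIn hS fun f hf hfP => ?_
  obtain ⟨g, hg, hgQ, hfg⟩ := T.exists_dominated_copy hS hQ fun x => (hfP x).2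
  exact (h f g hf hg (fun x => (hfP x).1) hgQ).1 hfg

variable {T} in
theorem Mixing.cn_light_outN_le [Finite W] {S : Tournament W} {c θ : ℕ} {P Q : Set V}
    (hS : ∀ X, c < T.cn X → T.ContainsIn S X) (h : T.Mixing S P Q)
    (hQ : c + Nat.card W * (θ + 1) < T.cn Q) :
    T.cn {x ∈ P | T.cn (T.outN x ∩ Q) ≤ θ} ≤ c := by
  have := h.op.cn_light_inN_le (c := c) (θ := θ) (fun X hX => by
    obtain ⟨f, hf, hfX⟩ := hS X (by rwa [← T.cn_op])
    exact ⟨f, fun x y hxy => hf y x hxy, hfX⟩) (by rwa [T.cn_op])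
  simp only [T.cn_op] at this
  exact this

/-- A vertex of `P` splits every set of a family of sets mixing with `P` into two heavy parts. -/
theorem exists_splitting_vertex [Finite W] {S : Tournament W} {c θ : ℕ} {P : Set V}
    (hS : ∀ X, c < T.cn X → T.ContainsIn S X) {n : ℕ} {Q : ℕ → Set V}
    (h : ∀ i < n, T.Mixing S P (Q i)) (hQ : ∀ i < n, c + Nat.card W * (θ + 1) < T.cn (Q i))
    (hP : n * (2 * c) < T.cn P) :
    ∃ x ∈ P, ∀ i < n, θ < T.cn (T.inN x ∩ Q i) ∧ θ < T.cn (T.outN x ∩ Q i) := by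
  by_contra! hcon
  have := T.cn_le_add_card_mul (X := P) (Y := ∅) (m := 2 * c) (s := Finset.range n)
    (B := fun i => {x ∈ P | T.cn (T.inN x ∩ Q i) ≤ θ} ∪ {x ∈ P | T.cn (T.outN x ∩ Q i) ≤ θ})
    (fun x hx => by
      obtain ⟨i, hi, hxi⟩ := hcon x hx
      refine Or.inr ⟨i, Finset.mem_range.2 hi, ?_⟩
      by_cases hx' : T.cn (T.inN x ∩ Q i) ≤ θ
      · exact Or.inl ⟨hx, hx'⟩
      · exact Or.inr ⟨hx, hxi (not_le.1 hx')⟩)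
    fun i hi => by
      have hi := Finset.mem_range.1 hi
      have := T.cn_union_le {x ∈ P | T.cn (T.inN x ∩ Q i) ≤ θ} {x ∈ P | T.cn (T.outN x ∩ Q i) ≤ θ}
      have := (h i hi).cn_light_inN_le hS (hQ i hi)
      have := (h i hi).cn_light_outN_le hS (hQ i hi)
      omega
  rw [cn_empty, Finset.card_range, zero_add] at this
  omega

end Finite

/-- A heavy mixing pair yields arbitrarily many pairwise mixing heavy sets: two vertices of `P` that
split `Q` suitably give a new heavy mixing pair inside `Q`, one part of which is kept while the
construction continues inside the other one. -/
theorem exists_mixing_family (d c M n : ℕ) :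
    ∃ t : ℕ, ∀ {V : Type u} [Finite V] (T : Tournament V), ¬ T.Contains (D (d + 1)) →
      (∀ X, c < T.cn X → T.ContainsIn (D d) X) → ∀ P Q : Set V, T.Mixing (D d) P Q →
      t < T.cn P → t < T.cn Q →
      ∃ R : ℕ → Set V, (∀ i < n, R i ⊆ Q ∧ M < T.cn (R i)) ∧
        ∀ i j, i < j → j < n → T.Mixing (D d) (R i) (R j) := by
  induction n with
  | zero => exact ⟨0, fun {V} _ T _ _ P Q _ _ _ => ⟨fun _ => ∅, by simp, by simp⟩⟩
  | succ n ih =>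
    obtain ⟨t, ht⟩ := ih
    set s := Nat.card (DVert d)
    set θ := c + s * (max t M + 1)
    refine ⟨max (2 * (2 * c)) (c + s * (θ + 1)), fun {V} _ T hT hD P Q hPQ hP hQ => ?_⟩
    have hP := (le_max_left _ _).trans_lt hP
    have hQ := (le_max_right _ _).trans_lt hQ
    obtain ⟨x, hxP, hx⟩ := T.exists_splitting_vertex hD (n := 1) (Q := fun _ => Q)
      (fun _ _ => hPQ) (fun _ _ => hQ) (by omega)
    obtain ⟨hx1, hx2⟩ := hx 0 one_pos
    obtain ⟨y, hyP, hy⟩ := T.exists_splitting_vertex hD (n := 2) (P := P) (θ := max t M)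
      (Q := fun i => if i = 0 then T.inN x ∩ Q else T.outN x ∩ Q)
      (by
        intro i _
        split_ifs
        · exact hPQ.mono subset_rfl Set.inter_subset_right
        · exact hPQ.mono subset_rfl Set.inter_subset_right)
      (by
        intro i _
        split_ifs
        · exact hx1
        · exact hx2) hP
    have hy1 := (hy 0 (by norm_num)).2
    have hy2 := (hy 1 (by norm_num)).1
    simp only [if_true, one_ne_zero, if_false] at hy1 hy2
    -- the two parts cross at `x` and `y`, hence they are mixing
    have hmix : T.Mixing (D d) (T.inN y ∩ (T.outN x ∩ Q)) (T.outN y ∩ (T.inN x ∩ Q)) :=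
      T.mixing_of_crossing hT (u := x) (v := y) (fun z hz => ⟨hz.2.1, hz.1⟩)
        fun z hz => ⟨hz.1, hz.2.1⟩
    obtain ⟨R, hR, hRR⟩ := ht T hT hD _ _ hmix ((le_max_left _ _).trans_lt hy2)
      ((le_max_left _ _).trans_lt hy1)
    refine ⟨fun i => Nat.casesOn i (T.inN y ∩ (T.outN x ∩ Q)) R, ?_, ?_⟩
    · rintro (_ | i) hi
      · exact ⟨fun z hz => hz.2.2, (le_max_right _ _).trans_lt hy2⟩
      · exact ⟨fun z hz => ((hR i (by omega)).1 hz).2.2, (hR i (by omega)).2⟩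
    · rintro (_ | i) (_ | j) hij hj
      · omega
      · exact hmix.mono subset_rfl (hR j (by omega)).1
      · omega
      · exact hRR i j (by omega) (by omega)

/-- Every tournament on `n` vertices can be embedded with its `i`-th vertex in the `i`-th set of a
family of `n` pairwise mixing sets with large clique number. The tournament is given by the pairs
`i < j` with `F i j`, those with an arc from the `i`-th to the `j`-th vertex. -/
theorem exists_pattern_of_mixing_family {W : Type*} [Finite W] (S : Tournament W) (c n : ℕ) :
    ∃ M : ℕ, ∀ {V : Type u} [Finite V] [Nonempty V] (T : Tournament V),
      (∀ X, c < T.cn X → T.ContainsIn S X) → ∀ R : ℕ → Set V,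
      (∀ i j, i < j → j < n → T.Mixing S (R i) (R j)) → (∀ i < n, M < T.cn (R i)) →
      ∀ F : ℕ → ℕ → Prop, ∃ x : ℕ → V, (∀ i < n, x i ∈ R i) ∧ ∀ i j, i < j → j < n →
        (F i j → T.Adj (x i) (x j)) ∧ (¬ F i j → T.Adj (x j) (x i)) := by
  classical
  induction n with
  | zero =>
    refine ⟨0, fun {V} _ hV T _ R _ _ F => ?_⟩
    obtain ⟨v⟩ := hV
    exact ⟨fun _ => v, by simp, by simp⟩
  | succ n ih =>
    obtain ⟨M, hM⟩ := ih
    refine ⟨max (n * (2 * c)) (c + Nat.card W * (M + 1)), fun {V} _ _ T hS R hmix hR F => ?_⟩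
    obtain ⟨x₀, hx₀, hx₀R⟩ := T.exists_splitting_vertex hS (n := n) (P := R 0)
      (Q := fun i => R (i + 1)) (θ := M) (fun i hi => hmix 0 (i + 1) (by omega) (by omega))
      (fun i hi => (le_max_right _ _).trans_lt (hR (i + 1) (by omega)))
      ((le_max_left _ _).trans_lt (hR 0 (by omega)))
    set R' : ℕ → Set V := fun i => (if F 0 (i + 1) then T.outN x₀ else T.inN x₀) ∩ R (i + 1)
    obtain ⟨x, hx, hxF⟩ := hM T hS R' (fun i j hij hj => (hmix (i + 1) (j + 1) (by omega)
        (by omega)).mono Set.inter_subset_right Set.inter_subset_right) (fun i hi => by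
      dsimp only [R']
      split_ifs
      · exact (hx₀R i hi).2
      · exact (hx₀R i hi).1) fun i j => F (i + 1) (j + 1)
    refine ⟨fun i => Nat.casesOn i x₀ x, ?_, ?_⟩
    · rintro (_ | i) hi
      · exact hx₀
      · exact (hx i (by omega)).2
    · rintro (_ | i) (_ | j) hij hj
      · omega
      · have := (hx j (by omega)).1
        refine ⟨fun h => ?_, fun h => ?_⟩
        · rwa [if_pos h] at this
        · rwa [if_neg h] at this
      · omega
      · exact hxF i j (by omega) (by omega)

/-! ### The asymmetric distance -/

/-- The distance from `u` to `v`: the clique number of the set of middle vertices of the directed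
paths of length two from `u` to `v`. -/
noncomputable def gap (u v : V) : ℕ := T.cn (T.outN u ∩ T.inN v)

/-- Without `D (d + 1)`, the distances between two vertices cannot both be large. -/
theorem exists_no_crossing (d c : ℕ) :
    ∃ h : ℕ, ∀ {V : Type u} [Finite V] (T : Tournament V), ¬ T.Contains (D (d + 1)) →
      (∀ X, c < T.cn X → T.ContainsIn (D d) X) → ∀ u v : V, h < T.gap u v → T.gap v u ≤ h := by
  classical
  have := Fintype.ofFinite (DVert (d + 1))
  set n := Fintype.card (DVert (d + 1))
  let ε : DVert (d + 1) ≃ Fin n := Fintype.equivFin _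
  obtain ⟨M, hM⟩ := exists_pattern_of_mixing_family.{u} (D d) c n
  obtain ⟨t, ht⟩ := exists_mixing_family.{u} d c M n
  refine ⟨t, fun {V} _ T hT hD u v huv => ?_⟩
  by_contra! hvu
  have : Nonempty V := ⟨u⟩
  obtain ⟨R, hR, hRR⟩ := ht T hT hD _ _ (T.mixing_of_crossing hT subset_rfl subset_rfl) huv hvu
  obtain ⟨x, -, hx⟩ := hM T hD R hRR (fun i hi => (hR i hi).2)
    fun i j => ∃ hi hj, (D (d + 1)).Adj (ε.symm ⟨i, hi⟩) (ε.symm ⟨j, hj⟩)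
  refine hT (T.contains_iff.2 ⟨fun p => x (ε p), fun p q hpq => ?_⟩)
  rcases lt_trichotomy (ε p) (ε q) with h | h | h
  · exact (hx _ _ h (ε q).2).1 ⟨(ε p).2, (ε q).2, by simpa using hpq⟩
  · rw [ε.injective h] at hpq
    exact absurd hpq (Tournament.loopless _ _)
  · refine (hx _ _ h (ε p).2).2 ?_
    rintro ⟨hi, hj, h'⟩
    exact (D (d + 1)).not_adj_of_adj hpq (by simpa using h')

theorem gap_self (v : V) : T.gap v v = 0 := by
  have : T.outN v ∩ T.inN v = ∅ :=
    Set.eq_empty_iff_forall_notMem.2 fun x hx => T.not_adj_of_adj hx.1 hx.2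
  rw [gap, this, cn_empty]

theorem gap_triangle [Finite V] (u v w : V) : T.gap u w ≤ T.gap u v + T.gap v w + 1 := by
  have h : T.outN u ∩ T.inN w ⊆ insert v ((T.outN u ∩ T.inN v) ∪ (T.outN v ∩ T.inN w)) := by
    intro x hx
    by_cases hxv : x = v
    · exact Or.inl hxv
    by_cases h : T.Adj x v
    · exact Or.inr (Or.inl ⟨hx.1, h⟩)
    · exact Or.inr (Or.inr ⟨T.adj_of_not_adj hxv h, hx.2⟩)
  exact (T.cn_mono h).trans ((T.cn_insert_le _ _).trans
    (Nat.add_le_add_right (T.cn_union_le _ _) 1))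

/-- The out-neighbours of `b` at small distance from `b` have light in-neighbourhoods among
themselves, and the in-neighbours of `b` at small distance to `b` have light out-neighbourhoods. -/
theorem exists_bound_ball (a c H : ℕ) :
    ∃ g : ℕ, ∀ {V : Type u} [Finite V] (T : Tournament V),
      ¬ T.Contains (A (a + 2)) → (∀ X, c < T.cn X → T.ContainsIn (A (a + 1)) X) → ∀ b : V,
      T.cn {v | T.gap v b ≤ H ∧ T.gap b v ≤ H} ≤ g := by
  obtain ⟨g₁, hg₁⟩ := exists_bound_of_inN_light.{u} a c H
  obtain ⟨g₂, hg₂⟩ := exists_bound_of_outN_light.{u} a c H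
  refine ⟨g₁ + g₂ + 1, fun {V} _ T hT hA b => ?_⟩
  set X := {v | T.gap v b ≤ H ∧ T.gap b v ≤ H}
  have h₁ := hg₁ T hT hA (X ∩ T.outN b) fun v hv =>
    (T.cn_mono (Y := T.outN b ∩ T.inN v) fun x hx => ⟨hx.2.2, hx.1⟩).trans hv.1.2
  have h₂ := hg₂ T hT hA (X ∩ T.inN b) fun v hv =>
    (T.cn_mono (Y := T.outN v ∩ T.inN b) fun x hx => ⟨hx.1, hx.2.2⟩).trans hv.1.1
  have h : X ⊆ insert b ((X ∩ T.outN b) ∪ (X ∩ T.inN b)) := by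
    intro x hx
    by_cases hxb : x = b
    · exact Or.inl hxb
    by_cases h : T.Adj x b
    · exact Or.inr (Or.inr ⟨hx, h⟩)
    · exact Or.inr (Or.inl ⟨hx, T.adj_of_not_adj hxb h⟩)
  have := (T.cn_mono h).trans (T.cn_insert_le _ _)
  have := T.cn_union_le (X ∩ T.outN b) (X ∩ T.inN b)
  omega

/-! ### Long reversed sequences of vertices at large distance -/

theorem exists_dominating_copy [Finite V] [Finite W] {S : Tournament W} {c θ : ℕ}
    (hS : ∀ X, c < T.cn X → T.ContainsIn S X) {Q : Set V} (hQ : c + Nat.card W * (θ + 1) < T.cn Q)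
    {f : W → V} (hf : ∀ x, T.cn (T.outN (f x) ∩ Q) ≤ θ) :
    ∃ g : W → V, IsHom S T g ∧ (∀ y, g y ∈ Q) ∧ ∀ x y, T.Adj (g y) (f x) := by
  obtain ⟨g, hg, hgQ, hfg⟩ := T.op.exists_dominated_copy (S := S.op) (c := c) (θ := θ) (Q := Q)
    (f := f) (fun X hX => by
      obtain ⟨f, hf, hfX⟩ := hS X (by rwa [← T.cn_op])
      exact ⟨f, fun x y hxy => hf y x hxy, hfX⟩) (by rwa [T.cn_op])
    fun x => by rw [T.cn_op]; exact hf x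
  exact ⟨g, fun x y hxy => hg y x hxy, hgQ, hfg⟩

/-- If the distance from `q` to `r` is large, then the in-neighbours of `q` at small distance to `r`
have bounded clique number: a copy of `D d` among them is dominated by another copy on the paths
from `q` to `r`, and these two form a copy of `D (d + 1)` with `q`. -/
theorem cn_near_le [Finite V] {d c h : ℕ} (hT : ¬ T.Contains (D (d + 1)))
    (hD : ∀ X, c < T.cn X → T.ContainsIn (D d) X) {q r : V}
    (hqr : c + Nat.card (DVert d) * (h + 1) < T.gap q r) :
    T.cn {w ∈ T.inN q | T.gap w r ≤ h} ≤ c := by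
  refine T.cn_le_of_containsIn hD fun f hf hfX => ?_
  obtain ⟨g, hg, hgQ, hgf⟩ := T.exists_dominating_copy (f := f) hD hqr fun x =>
    (T.cn_mono (Y := T.outN (f x) ∩ T.inN r) fun y hy => ⟨hy.1, hy.2.2⟩).trans (hfX x).2
  exact hT (T.contains_D_succ (z := q) hg hf (fun x y => hgf y x) (fun y => (hfX y).1)
    fun x => (hgQ x).1)

/-- The vertices of even index are the extra vertices of the copy of `A (a + 1)`. The `i`-th copy of
`A a` is found between `u (2 * i)` and `u (2 * i + 1)`; all but a light part of this set has the
right arcs to the `u (2 * k)`, as the distances backwards are small. Being far from `u (2 * k)`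
for later `k` ensures that each vertex of the copy also dominates all but a light part of the sets
used later. -/
theorem contains_A_succ_of_far_reversed [Finite V] {a d c h H : ℕ} {u : ℕ → V}
    (hT : ¬ T.Contains (D (d + 1)))
    (hA : ∀ X, c < T.cn X → T.ContainsIn (A a) X) (hD : ∀ X, c < T.cn X → T.ContainsIn (D d) X)
    (hcross : ∀ u v : V, h < T.gap u v → T.gap v u ≤ h)
    (hadj : ∀ i j, i < j → j ≤ 2 * a → T.Adj (u j) (u i))
    (hfar : ∀ i j, i < j → j ≤ 2 * a → H < T.gap (u i) (u j))
    (hH : h + c + Nat.card (DVert d) * (h + 1) + (a + 1) * (h + 1 + c) +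
      a * Nat.card (AVert a) * (h + 1) ≤ H) :
    T.Contains (A (a + 1)) := by
  classical
  have := Fintype.ofFinite (AVert a)
  have hback : ∀ i j, i < j → j ≤ 2 * a → T.gap (u j) (u i) ≤ h := fun i j hij hj =>
    hcross _ _ (lt_of_le_of_lt (by omega) (hfar i j hij hj))
  -- the `i`-th copy of `A a` will be found in the set `J i`
  set J : ℕ → Set V := fun i => T.outN (u (2 * i)) ∩ T.inN (u (2 * i + 1))
  -- the vertices of `J i` with the required relations to all extra vertices
  set J' : ℕ → Set V := fun i => {x ∈ J i | (∀ k ≤ i, T.Adj (u (2 * k)) x) ∧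
    ∀ k, i < k → k ≤ a → T.Adj x (u (2 * k)) ∧ h < T.gap x (u (2 * k))}
  have hJ : ∀ i < a, H < T.cn (J i) := fun i hi => hfar _ _ (by omega) (by omega)
  -- `B k` contains the vertices of `J i` violating the condition on `u (2 * k)`
  have hJ' : ∀ i < a, T.cn (J i) ≤ T.cn (J' i) + (a + 1) * (h + 1 + c) := by
    intro i hi
    set B : ℕ → Set V := fun k => if k ≤ i then
        insert (u (2 * k)) (T.outN (u (2 * i)) ∩ T.inN (u (2 * k)))
      else insert (u (2 * k)) (T.outN (u (2 * k)) ∩ T.inN (u (2 * i + 1))) ∪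
        {w ∈ T.inN (u (2 * i + 1)) | T.gap w (u (2 * k)) ≤ h}
    have := T.cn_le_add_card_mul (X := J i) (Y := J' i) (s := Finset.range (a + 1)) (B := B)
      (m := h + 1 + c) (fun x hx => ?_) (fun k hk => ?_)
    · simpa using this
    · by_contra! hcon
      refine hcon.1 ⟨hx, fun k hk => ?_, fun k hik hk => ⟨?_, ?_⟩⟩
      · by_contra hn
        refine hcon.2 k (by simp; omega) ?_
        simp only [B, if_pos hk]
        by_cases hxk : x = u (2 * k)
        · exact Or.inl hxk
        · exact Or.inr ⟨hx.1, T.adj_of_not_adj (Ne.symm hxk) hn⟩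
      · by_contra hn
        refine hcon.2 k (by simp; omega) ?_
        simp only [B, if_neg hik.not_ge]
        refine Or.inl ?_
        by_cases hxk : x = u (2 * k)
        · exact Or.inl hxk
        · exact Or.inr ⟨T.adj_of_not_adj hxk hn, hx.2⟩
      · by_contra hn
        refine hcon.2 k (by simp; omega) ?_
        simp only [B, if_neg hik.not_ge]
        exact Or.inr ⟨hx.2, not_lt.1 hn⟩
    · have hk : k < a + 1 := Finset.mem_range.1 hk
      by_cases hki : k ≤ i
      · simp only [B, if_pos hki]
        have h1 := T.cn_insert_le (u (2 * k)) (T.outN (u (2 * i)) ∩ T.inN (u (2 * k)))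
        have h2 : T.gap (u (2 * i)) (u (2 * k)) ≤ h := by
          rcases hki.eq_or_lt with rfl | hlt
          · simp [gap_self]
          · exact hback _ _ (by omega) (by omega)
        exact h1.trans (by simp only [gap] at h2; omega)
      · simp only [B, if_neg hki]
        have h1 := T.cn_insert_le (u (2 * k)) (T.outN (u (2 * k)) ∩ T.inN (u (2 * i + 1)))
        have h2 : T.gap (u (2 * k)) (u (2 * i + 1)) ≤ h := hback _ _ (by omega) (by omega)
        have h3 : T.cn {w ∈ T.inN (u (2 * i + 1)) | T.gap w (u (2 * k)) ≤ h} ≤ c :=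
          T.cn_near_le hT hD (lt_of_le_of_lt (by omega)
            (hfar (2 * i + 1) (2 * k) (by omega) (by omega)))
        exact (T.cn_union_le _ _).trans (Nat.add_le_add (h1.trans (Nat.add_le_add_right h2 1)) h3)
  obtain ⟨f, hf, hff⟩ : ∃ f : ℕ → AVert a → V,
      (∀ i < a, IsHom (A a) T (f i) ∧ ∀ x, f i x ∈ J' i) ∧
      ∀ i j, i < j → j < a → ∀ x y, T.Adj (f i x) (f j y) := by
    suffices ∀ n ≤ a, ∃ f : ℕ → AVert a → V,
        (∀ i < n, IsHom (A a) T (f i) ∧ ∀ x, f i x ∈ J' i) ∧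
        ∀ i j, i < j → j < n → ∀ x y, T.Adj (f i x) (f j y) from this a le_rfl
    intro n
    induction n with
    | zero => exact fun _ => ⟨fun _ _ => u 0, by simp, by simp⟩
    | succ n ih =>
      intro hn
      obtain ⟨f, hf, hff⟩ := ih (by omega)
      obtain ⟨g, hg, hgX⟩ := hA {y ∈ J' n | ∀ i < n, ∀ x, T.Adj (f i x) y} (by
        have h1 := T.cn_le_add_card_mul (X := J' n) (m := h + 1)
          (Y := {y ∈ J' n | ∀ i < n, ∀ x, T.Adj (f i x) y})
          (s := (Finset.univ : Finset (Fin n × AVert a)))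
          (B := fun p => insert (f p.1 p.2) (T.outN (u (2 * n)) ∩ T.inN (f p.1 p.2)))
          (fun y hy => by
            by_cases hy' : ∀ i < n, ∀ x, T.Adj (f i x) y
            · exact Or.inl ⟨hy, hy'⟩
            push Not at hy'
            obtain ⟨i, hi, x, hx⟩ := hy'
            refine Or.inr ⟨(⟨i, hi⟩, x), Finset.mem_univ _, ?_⟩
            by_cases hyx : y = f i x
            · exact Or.inl hyx
            · exact Or.inr ⟨hy.1.1, T.adj_of_not_adj (Ne.symm hyx) hx⟩)
          (fun p _ => (T.cn_insert_le _ _).trans (Nat.add_le_add_right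
            (hcross _ _ (((hf p.1 p.1.2).2 p.2).2.2 n p.1.2 (by omega)).2) 1))
        have h2 := hJ n (by omega)
        have h3 := hJ' n (by omega)
        rw [Finset.card_univ, Fintype.card_prod, Fintype.card_fin,
          ← Nat.card_eq_fintype_card] at h1
        have h4 : n * Nat.card (AVert a) * (h + 1) ≤ a * Nat.card (AVert a) * (h + 1) :=
          Nat.mul_le_mul_right _ (Nat.mul_le_mul_right _ (by omega))
        omega)
      refine ⟨fun i => if i < n then f i else g, fun i hi => ?_, fun i j hij hj => ?_⟩
      · rcases Nat.lt_or_ge i n with hin | hin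
        · simpa only [if_pos hin] using hf i hin
        · obtain rfl : i = n := by omega
          simpa only [if_neg (lt_irrefl i)] using ⟨hg, fun x => (hgX x).1⟩
      · rcases Nat.lt_or_ge j n with hjn | hjn
        · simpa only [if_pos hjn, if_pos (hij.trans hjn)] using hff i j hij hjn
        · obtain rfl : j = n := by omega
          simpa only [if_neg (lt_irrefl j), if_pos hij] using
            fun x y => (hgX y).2 i hij x
  exact T.contains_aStep (v := fun i => u (2 * i)) (fun i hi => (hf i hi).1) hff
    (fun i j hij hj => hadj _ _ (by omega) (by omega))
    (fun i j hij hj x => ((hf j hj).2 x).2.1 i hij)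
    (fun i j hij hj x => (((hf j (by omega)).2 x).2.2 i hij hj).1)

/-! ### Gluing orderings along a function -/

/-- Ordering `X` by the values of `β`, and each fibre of `β` optimally, gives a bound for the clique
number of `X` if there is no long sequence along which `β` increases and all arcs go backwards. -/
theorem cn_le_mul_of_fibers [Finite V] {X : Set V} (β : V → ℕ) {m q : ℕ}
    (hm : ∀ b, T.cn {x ∈ X | β x = b} ≤ m)
    (hq : ∀ w : ℕ → V, (∀ i ≤ q, w i ∈ X) →
      (∀ i j, i < j → j ≤ q → β (w i) < β (w j) ∧ T.Adj (w j) (w i)) → False) :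
    T.cn X ≤ m * q := by
  classical
  have := Fintype.ofFinite V
  choose r hr hrK using fun b => T.orderBound_cn {x ∈ X | β x = b}
  set N := Finset.univ.sup (fun x => r (β x) x) + 1
  have hN : ∀ x, r (β x) x < N := fun x =>
    Nat.lt_succ_of_le (Finset.le_sup (f := fun x => r (β x) x) (Finset.mem_univ x))
  set ρ : V → ℕ := fun x => β x * N + r (β x) x with hρ
  have hlt : ∀ x y, β x < β y → ρ x < ρ y := by
    intro x y hxy
    have h1 := hN x
    have h2 : (β x + 1) * N ≤ β y * N := Nat.mul_le_mul_right _ hxy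
    simp only [hρ]
    rw [Nat.succ_mul] at h2
    omega
  refine cn_le ⟨ρ, fun x hx y hy hxy => ?_, fun K hKX hrev => ?_⟩
  · have hβ : β x = β y := by
      by_contra hne
      rcases Nat.lt_or_gt_of_ne hne with h | h
      · exact (hlt x y h).ne hxy
      · exact (hlt y x h).ne' hxy
    refine hr (β y) ⟨hx, hβ⟩ ⟨hy, rfl⟩ ?_
    simp only [hρ, hβ] at hxy
    omega
  · have h1 : K.card ≤ m * (K.image β).card := by
      refine Finset.card_le_mul_card_image K m fun b _ => (hrK b _ ?_ ?_).trans (hm b)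
      · intro x hx
        have hx := Finset.mem_filter.1 hx
        exact ⟨hKX hx.1, hx.2⟩
      · intro x hx y hy hxy
        have hx := Finset.mem_filter.1 hx
        have hy := Finset.mem_filter.1 hy
        refine hrev x hx.1 y hy.1 ?_
        simp only [hρ, hx.2, hy.2]
        omega
    refine h1.trans (Nat.mul_le_mul_left _ ?_)
    by_contra! hcard
    have hpre : ∀ i : Fin (K.image β).card,
        ∃ x ∈ K, β x = (K.image β).orderEmbOfFin rfl i := fun i =>
      Finset.mem_image.1 (Finset.orderEmbOfFin_mem _ rfl i)
    choose x hxK hxβ using hpre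
    have hx : ∀ i (hi : i ≤ q), i < (K.image β).card := fun i hi => by omega
    refine hq (fun i => if hi : i ≤ q then x ⟨i, hx i hi⟩ else x ⟨0, hx 0 (by omega)⟩)
      (fun i hi => ?_) fun i j hij hj => ?_
    · simp only [dif_pos hi]
      exact hKX (hxK _)
    · simp only [dif_pos hj, dif_pos (hij.le.trans hj)]
      have hβ : β (x ⟨i, hx i (hij.le.trans hj)⟩) < β (x ⟨j, hx j hj⟩) := by
        rw [hxβ, hxβ]
        exact ((K.image β).orderEmbOfFin rfl).strictMono hij
      exact ⟨hβ, hrev _ (hxK _) _ (hxK _) (hlt _ _ hβ)⟩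

/-! ### Chains of distant vertices -/

/-- The first `t` vertices of the sequence `b` form a chain, in which every vertex has distance
more than `H` to its successor. -/
def IsChain (H t : ℕ) (b : ℕ → V) : Prop := ∀ i, i + 1 < t → H < T.gap (b i) (b (i + 1))

variable {T} in
/-- The loss of `h + 1` does not accumulate along the chain, as the way back from `b j` to `b i` is
short. -/
theorem IsChain.lt_gap [Finite V] {h H t : ℕ} {b : ℕ → V}
    (hcross : ∀ u v : V, h < T.gap u v → T.gap v u ≤ h) (hH : 2 * h < H) (hb : T.IsChain H t b)
    {i j : ℕ} (hij : i < j) (hj : j < t) : H < T.gap (b i) (b j) + h + 1 := by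
  induction j, hij using Nat.le_induction with
  | base =>
    have := hb i hj
    simp only [Nat.succ_eq_add_one] at *
    omega
  | succ j hij ih =>
    have h1 := hcross _ _ (show h < T.gap (b i) (b j) by have := ih (by omega); omega)
    have h2 := hb j hj
    have h3 := T.gap_triangle (b j) (b i) (b (j + 1))
    omega

variable {T} in
/-- Inserting `v` into the chain as its `p`-th vertex. -/
theorem IsChain.insert {H t p : ℕ} {b : ℕ → V} (hb : T.IsChain H t b) (hp : p ≤ t) (v : V)
    (h1 : ∀ i, i + 1 = p → H < T.gap (b i) v) (h2 : p < t → H < T.gap v (b p)) :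
    T.IsChain H (t + 1) (fun i => if i < p then b i else if i = p then v else b (i - 1)) := by
  intro i hi
  dsimp only
  rcases lt_trichotomy (i + 1) p with h | h | h
  · simpa only [if_pos h, if_pos (show i < p by omega)] using hb i (by omega)
  · simpa only [if_pos (show i < p by omega), if_neg (show ¬ i + 1 < p by omega), if_pos h]
      using h1 i h
  · rcases (show i = p ∨ p < i by omega) with rfl | h'
    · simpa [show ¬ i + 1 < i by omega] using h2 (by omega)
    · have := hb (i - 1) (by omega)
      rw [Nat.sub_add_cancel (by omega)] at this
      simpa [show ¬ i + 1 < p by omega, show ¬ i < p by omega, show ¬ i + 1 = p by omega,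
        show ¬ i = p by omega] using this

/-- Chains consist of distinct vertices, so there is a longest one. -/
theorem exists_maximal_chain [Finite V] [Nonempty V] {h H : ℕ}
    (hcross : ∀ u v : V, h < T.gap u v → T.gap v u ≤ h) (hH : 2 * h < H) :
    ∃ (t : ℕ) (b : ℕ → V), T.IsChain H t b ∧ ∀ b', ¬ T.IsChain H (t + 1) b' := by
  by_contra! hcon
  have hall : ∀ t, ∃ b, T.IsChain H t b := by
    intro t
    induction t with
    | zero =>
      obtain ⟨v⟩ := ‹Nonempty V›
      exact ⟨fun _ => v, fun i hi => by omega⟩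
    | succ t ih =>
      obtain ⟨b, hb⟩ := ih
      exact hcon t b hb
  have := Fintype.ofFinite V
  obtain ⟨b, hb⟩ := hall (Fintype.card V + 1)
  obtain ⟨i, j, hne, hij⟩ := Fintype.exists_ne_map_eq_of_card_lt
    (fun i : Fin (Fintype.card V + 1) => b i) (by simp)
  wlog hlt : i < j generalizing i j
  · exact this j i hne.symm hij.symm (lt_of_le_of_ne (not_lt.1 hlt) hne.symm)
  have := hb.lt_gap hcross hH hlt j.2
  rw [hij, gap_self] at this
  omega

/-- The position of a vertex `v` relative to a chain: `p` is the first index from which on all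
distances from the chain to `v` are at most `H`. -/
theorem exists_position (t H : ℕ) (b : ℕ → V) (v : V) :
    ∃ p ≤ t, (∀ i, i + 1 = p → H < T.gap (b i) v) ∧
      ∀ i, p ≤ i → i < t → T.gap (b i) v ≤ H := by
  classical
  have hex : ∃ p, ∀ i, p ≤ i → i < t → T.gap (b i) v ≤ H := ⟨t, fun i h1 h2 => by omega⟩
  refine ⟨Nat.find hex, Nat.find_min' hex fun i h1 h2 => by omega, fun i hi => ?_,
    Nat.find_spec hex⟩
  have := Nat.find_min hex (m := i) (by omega)
  push Not at this
  obtain ⟨j, h1, h2, h3⟩ := this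
  rcases h1.eq_or_lt with rfl | h1
  · exact h3
  · exact absurd (Nat.find_spec hex j (by omega) h2) (not_le.2 h3)

/-- If distances are never large in both directions, balls have clique number at most `g`, and there
is no sequence of length `q + 1` along which all arcs go backwards and all distances forwards are
more than `H₁`, then the whole tournament has bounded clique number. -/
theorem cn_univ_le [Finite V] [Nonempty V] {h H₁ g q : ℕ}
    (hcross : ∀ u v : V, h < T.gap u v → T.gap v u ≤ h) (hH₁ : 0 < H₁)
    (hball : ∀ b : V, T.cn {v | T.gap v b ≤ H₁ + 2 * h + 2 ∧ T.gap b v ≤ H₁ + 2 * h + 2} ≤ g)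
    (hfar : ∀ w : ℕ → V, (∀ i j, i < j → j ≤ q → T.Adj (w j) (w i)) →
      (∀ i j, i < j → j ≤ q → H₁ < T.gap (w i) (w j)) → False) :
    T.cn Set.univ ≤ 3 * (2 * g * q) := by
  set H := H₁ + 2 * h + 2 with hH
  obtain ⟨t, b, hb, hmax⟩ := T.exists_maximal_chain hcross (show 2 * h < H by omega)
  choose p hpt hp1 hp2 using T.exists_position t (H₁ + h + 1) b
  -- otherwise `v` could be inserted into the chain at its position
  have hnear : ∀ v, (∃ i, i + 1 = p v ∧ T.gap v (b i) ≤ H ∧ T.gap (b i) v ≤ H) ∨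
      (T.gap v (b (p v)) ≤ H ∧ T.gap (b (p v)) v ≤ H) := by
    intro v
    by_contra! hcon
    refine hmax _ (hb.insert (hpt v) v (fun i hi => ?_) fun hpt' => ?_)
    · have := hp1 v i hi
      exact hcon.1 i hi ((hcross _ _ (by omega)).trans (by omega))
    · by_contra! hle
      have := hp2 v (p v) le_rfl hpt'
      have := hcon.2 hle
      omega
  have hfiber : ∀ k, T.cn {v | p v = k} ≤ 2 * g := by
    intro k
    have hsub : {v | p v = k} ⊆ {v | T.gap v (b (k - 1)) ≤ H ∧ T.gap (b (k - 1)) v ≤ H} ∪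
        {v | T.gap v (b k) ≤ H ∧ T.gap (b k) v ≤ H} := by
      rintro v rfl
      rcases hnear v with ⟨i, hi, hv⟩ | hv
      · exact Or.inl (by rw [← hi]; exact hv)
      · exact Or.inr hv
    have := (T.cn_mono hsub).trans (T.cn_union_le _ _)
    have := hball (b k)
    have := hball (b (k - 1))
    omega
  -- the distance from a vertex to the chain is large from two places after its position on
  have hchain : ∀ u k, p u + 2 ≤ k → k < t → H < T.gap u (b k) + h + 1 := by
    have hfst : ∀ u k, p u + 1 ≤ k → k < t → T.gap (b k) u ≤ h := by
      intro u k hk hkt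
      obtain ⟨j, rfl⟩ : ∃ j, k = j + 1 := ⟨k - 1, by omega⟩
      refine hcross _ _ ?_
      have := hp2 u j (by omega) (by omega)
      have := hb j hkt
      have := T.gap_triangle (b j) u (b (j + 1))
      omega
    intro u k hk hkt
    obtain ⟨j, rfl⟩ : ∃ j, k = j + 1 := ⟨k - 1, by omega⟩
    have := hfst u j (by omega) (by omega)
    have := hb j hkt
    have := T.gap_triangle (b j) u (b (j + 1))
    omega
  have hdist : ∀ u v, p u + 3 ≤ p v → H₁ < T.gap u v := by
    intro u v huv
    obtain ⟨k, hk⟩ : ∃ k, k + 1 = p v := ⟨p v - 1, by omega⟩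
    have := hpt v
    have := hchain u k (by omega) (by omega)
    have := hcross _ _ (show h < T.gap (b k) v by have := hp1 v k hk; omega)
    have := T.gap_triangle u v (b k)
    omega
  have hclass : ∀ r, T.cn {v | p v % 3 = r} ≤ 2 * g * q := by
    intro r
    refine T.cn_le_mul_of_fibers p (fun k => (T.cn_mono fun x hx => hx.2).trans (hfiber k))
      fun w hw hwp => hfar w (fun i j hij hj => (hwp i j hij hj).2) fun i j hij hj => ?_
    have h1 : p (w i) % 3 = r := hw i (by omega)
    have h2 : p (w j) % 3 = r := hw j hj
    have h3 := (hwp i j hij hj).1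
    exact hdist _ _ (by omega)
  have := T.cn_le_add_card_mul (X := Set.univ) (Y := ∅) (s := Finset.range 3)
    (B := fun r => {v | p v % 3 = r}) (m := 2 * g * q)
    (fun v _ => Or.inr ⟨p v % 3, Finset.mem_range.2 (Nat.mod_lt _ (by norm_num)), rfl⟩)
    fun r _ => hclass r
  simpa using this

/-! ### Induction on the forbidden tournaments -/

theorem exists_bound_step (a d c : ℕ) :
    ∃ C : ℕ, ∀ {V : Type u} [Finite V] (T : Tournament V),
      ¬ T.Contains (A (a + 2)) → ¬ T.Contains (D (d + 1)) →
      (∀ X, c < T.cn X → T.ContainsIn (A (a + 1)) X) →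
      (∀ X, c < T.cn X → T.ContainsIn (D d) X) → T.cn Set.univ ≤ C := by
  obtain ⟨h, hh⟩ := exists_no_crossing.{u} d c
  set H₁ := h + c + Nat.card (DVert d) * (h + 1) + (a + 1 + 1) * (h + 1 + c) +
      (a + 1) * Nat.card (AVert (a + 1)) * (h + 1) with hH₁
  obtain ⟨g, hg⟩ := exists_bound_ball.{u} a c (H₁ + 2 * h + 2)
  refine ⟨3 * (2 * g * (2 * (a + 1))), fun {V} _ T hTA hTD hA hD => ?_⟩
  rcases isEmpty_or_nonempty V with hV | hV
  · simp [Set.univ_eq_empty_iff.2 hV]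
  · exact T.cn_univ_le (hh T hTD hD) (by positivity) (hg T hTA hA) fun w hadj hfar =>
      hTA (T.contains_A_succ_of_far_reversed hTD hA hD (hh T hTD hD) hadj hfar hH₁.ge)

/-- The subtournament induced by a vertex set. -/
def induce (X : Set V) : Tournament X where
  Adj u v := T.Adj u v
  loopless v := T.loopless v
  adj_iff_not_adj u v h := T.adj_iff_not_adj u v fun e => h (Subtype.ext e)

theorem cn_le_cn_induce [Finite V] (X : Set V) : T.cn X ≤ (T.induce X).cn Set.univ := by
  classical
  obtain ⟨r, hr, hK⟩ := (T.induce X).orderBound_cn Set.univ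
  refine cn_le ⟨fun v => if hv : v ∈ X then r ⟨v, hv⟩ else 0, fun x hx y hy hxy => ?_,
    fun K hKX hrev => ?_⟩
  · simp only [dif_pos hx, dif_pos hy] at hxy
    exact congrArg Subtype.val (hr (Set.mem_univ _) (Set.mem_univ _) hxy)
  · have := hK (K.subtype (· ∈ X)) (Set.subset_univ _) fun u hu v hv huv =>
      hrev u (Finset.mem_subtype.1 hu) v (Finset.mem_subtype.1 hv) (by simpa using huv)
    rwa [Finset.card_subtype, Finset.filter_true_of_mem fun x hx => hKX hx] at this

theorem containsIn_of_contains_induce {S : Tournament W} {X : Set V}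
    (h : (T.induce X).Contains S) : T.ContainsIn S X := by
  obtain ⟨φ, hφ⟩ := (T.induce X).contains_iff.1 h
  exact ⟨fun w => φ w, hφ, fun w => (φ w).2⟩

theorem contains_of_containsIn {S : Tournament W} {X : Set V} (h : T.ContainsIn S X) :
    T.Contains S := by
  obtain ⟨φ, hφ, -⟩ := h
  exact T.contains_iff.2 ⟨φ, hφ⟩

theorem contains_induce {S : Tournament W} {X : Set V} (h : (T.induce X).Contains S) :
    T.Contains S :=
  T.contains_of_containsIn (T.containsIn_of_contains_induce h)

theorem contains_A_zero : T.Contains (A 0) :=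
  T.contains_iff.2 ⟨fun x => x.elim, fun x => x.elim⟩

theorem contains_D_zero : T.Contains (D 0) :=
  T.contains_iff.2 ⟨fun x => x.elim, fun x => x.elim⟩

/-- Sets containing no `A (a + 1)`, or no `D d`, have bounded clique number by induction. -/
theorem exists_bound_cn (a d : ℕ) :
    ∃ c : ℕ, ∀ {V : Type u} [Finite V] (T : Tournament V),
      ¬ T.Contains (A a) → ¬ T.Contains (D d) → T.cn Set.univ ≤ c := by
  induction a generalizing d with
  | zero => exact ⟨0, fun {V} _ T h _ => absurd T.contains_A_zero h⟩
  | succ a iha =>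
    rcases a with _ | a
    · refine ⟨0, fun {V} _ T h _ => ?_⟩
      have : IsEmpty V := ⟨fun v => h (T.contains_aStep (S := A 0) (n := 0)
        (f := fun _ x => x.elim) (v := fun _ => v) (by simp) (by simp) (by omega)
        (by simp) (by omega))⟩
      simp [Set.univ_eq_empty_iff.2 this]
    induction d with
    | zero => exact ⟨0, fun {V} _ T _ h => absurd T.contains_D_zero h⟩
    | succ d ihd =>
      obtain ⟨c₁, hc₁⟩ := iha (d + 1)
      obtain ⟨c₂, hc₂⟩ := ihd
      obtain ⟨C, hC⟩ := exists_bound_step.{u} a d (max c₁ c₂)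
      refine ⟨C, fun {V} _ T hA hD => hC T hA hD (fun X hX => ?_) fun X hX => ?_⟩
      · by_contra hcon
        have h1 := hc₁ (T.induce X) (fun h => hcon (T.containsIn_of_contains_induce h))
          fun h => hD (T.contains_induce h)
        have h2 := T.cn_le_cn_induce X
        omega
      · by_contra hcon
        have h1 := hc₂ (T.induce X) (fun h => hA (T.contains_induce h))
          fun h => hcon (T.containsIn_of_contains_induce h)
        have h2 := T.cn_le_cn_induce X
        omega

/-! ### The largest contained tournaments -/

theorem le_card_AVert : ∀ n, n ≤ Nat.card (AVert n)
  | 0 => Nat.zero_le _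
  | n + 1 => by
    have := Nat.card_le_card_of_injective
      (Sum.inr : Fin (n + 1) → (Fin n × AVert n) ⊕ Fin (n + 1)) Sum.inr_injective
    rwa [Nat.card_fin] at this

theorem le_card_DVert : ∀ n, n ≤ Nat.card (DVert n)
  | 0 => Nat.zero_le _
  | n + 1 => by
    have := le_card_DVert n
    change n + 1 ≤ Nat.card (DVert n ⊕ DVert n ⊕ Unit)
    rw [Nat.card_sum, Nat.card_sum, Nat.card_unique (α := Unit)]
    omega

theorem card_le_of_contains [Finite V] {S : Tournament W} (h : T.Contains S) :
    Nat.card W ≤ Nat.card V := by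
  obtain ⟨f⟩ := h
  exact Nat.card_le_card_of_injective f f.injective

theorem not_contains_A_of_omegaA_lt [Finite V] {n : ℕ} (h : T.omegaA < n) :
    ¬ T.Contains (A n) := fun hn =>
  h.not_ge (le_csSup ⟨Nat.card V, fun m hm => (le_card_AVert m).trans (T.card_le_of_contains hm.2)⟩
    ⟨by omega, hn⟩)

theorem not_contains_D_of_omegaD_lt [Finite V] {n : ℕ} (h : T.omegaD < n) :
    ¬ T.Contains (D n) := fun hn =>
  h.not_ge (le_csSup ⟨Nat.card V, fun m hm => (le_card_DVert m).trans (T.card_le_of_contains hm.2)⟩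
    ⟨by omega, hn⟩)

end Tournament

theorem mainTheorem1 :
    (∀ n : ℕ, 1 ≤ n → ∃ c : ℕ, ∀ (V : Type*) [Finite V] (T : Tournament V),
      ¬ T.Contains (Tournament.A n) → ¬ T.Contains (Tournament.D n) → T.cliqueNum ≤ c) ∧
    (∃ f : ℕ → ℕ, ∀ (V : Type*) [Finite V] (T : Tournament V),
      T.cliqueNum < f (T.omegaA + T.omegaD)) := by
  refine ⟨fun n _ => ?_, ?_⟩
  · obtain ⟨c, hc⟩ := Tournament.exists_bound_cn n n
    exact ⟨c, fun V _ T hA hD => T.cliqueNum_le_cn_univ.trans (hc T hA hD)⟩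
  · choose c hc using fun n => Tournament.exists_bound_cn n n
    exact ⟨fun k => c (k + 1) + 1, fun V _ T => Nat.lt_succ_of_le
      (T.cliqueNum_le_cn_univ.trans (hc _ T (T.not_contains_A_of_omegaA_lt (by omega))
        (T.not_contains_D_of_omegaD_lt (by omega))))⟩
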